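/- All logarithms are to base $2$ and $\exp(x)=2^x$. Let $\mathcal H$ be a complex Hilbert space of finite dimension $d$, let $\rho>0$ be a positive definite density operator on $\mathcal H$ ($\operatorname{Tr}\rho=1$), and let $\mathbf a=(a_j)_{j=1,\dots,m}$ be a POVM on $\mathcal H$ (that is, $a_j\ge 0$ and $\sum_j a_j=\mathbb 1$). Put $\lambda_j=\operatorname{Tr}(\rho a_j)$, $\hat\rho_j=\frac{1}{\lambda_j}\sqrt\rho\,a_j\sqrt\rho$, $\lambda_0=\min_j\lambda_j$, and let $H(\sigma)=-\operatorname{Tr}\sigma\log\sigma$ denote the von Neumann entropy. For a POVM $\mathbf A=(A_\mu)_{\mu=1,\dots,M}$ on $\mathcal H^{\otimes l}$ whose outcomes $\mu$ are labelled by tuples of guesses $j^l_\mu=(j_{\mu1},\dots,j_{\mu l})\in\{1,\dots,m\}^l$, define its marginals, for $k=1,\dots,l$ and $j=1,\dots,m$, by $$A^{(k)}_j=\operatorname{Tr}_{\neq k}\Bigl(\bigl(\rho^{\otimes[l]\setminus k}\otimes\mathbb 1_k\bigr)\sum_{\mu:\,j_{\mu k}=j}A_\mu\Bigr),$$ where $\operatorname{Tr}_{\neq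 k}$ is the partial trace over all tensor factors except the $k$-th. Let $\|\cdot\|$ be the operator norm. 1. Let $0<\epsilon\le(\lambda_0/2)^2$. Then for every $l$, every POVM $\mathbf A=(A_\mu)_{\mu=1,\dots,M}$ on $\mathcal H^{\otimes l}$, labelled as above, such that $$\forall k\quad \sum_j\|A^{(k)}_j-a_j\|\le\epsilon$$ has $$M\ \ge\ \exp\Bigl(l\Bigl(H(\rho)-\sum_j\lambda_jH(\hat\rho_j)+\frac{3\epsilon}{\lambda_0^2}\log\frac{2\epsilon}{\lambda_0^2d}\Bigr)\Bigr)$$ outcomes. 2. Consequently the entropy defect $H(\rho)-\sum_j\lambda_jH(\hat\rho_j)$ is an asymptotically optimal rate, in the sense that no smaller rate suffices: if $\lambda_0>0$, then for every $\delta>0$ there is $\epsilon_0>0$ such that for every $l$, every labelled POVM $\mathbf A$ on $\mathcal H^{\otimes l}$ with $\sum_j\|A^{(k)}_j-a_j\|\le\epsilon_0$ for all $k$ has $M\ge\exp\bigl(l(H(\rho)-\sum_j\lambda_jH(\hat\rho_j)-\delta)\bigr)$ outcomes. -/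

import Mathlib

open scoped Matrix ComplexOrder

noncomputable section

namespace MeasurementCompression

/-- A POVM with finitely many outcomes `μ : κ` on the Hilbert space `ℂ^n`: a family of positive
semidefinite operators that sums to the identity. -/
structure IsPOVM {κ n : Type*} [Fintype κ] [Fintype n] [DecidableEq n]
    (A : κ → Matrix n n ℂ) : Prop where
  posSemidef : ∀ μ, (A μ).PosSemidef
  sum_eq_one : ∑ μ, A μ = 1

/-- The operator (sup) norm of a matrix acting on the Euclidean space `ℂ^n`. -/
def opNorm {n : Type*} [Fintype n] [DecidableEq n] (X : Matrix n n ℂ) : ℝ :=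
  ‖Matrix.toEuclideanCLM (n := n) (𝕜 := ℂ) X‖

/-- The von Neumann entropy `H(σ) = -Tr σ log σ`, in bits. The logarithm is taken in the functional
calculus; Lean's `log 0 = 0` implements the convention `0 log 0 = 0`. -/
def entropy {n : Type*} [Fintype n] [DecidableEq n] (σ : Matrix n n ℂ) : ℝ :=
  -(σ * cfc (Real.logb 2) σ).trace.re

/-- The positive square root of a positive semidefinite matrix. -/
def msqrt {n : Type*} [Fintype n] [DecidableEq n] (σ : Matrix n n ℂ) : Matrix n n ℂ :=
  cfc Real.sqrt σ

/-- The tensor product `B 1 ⊗ ⋯ ⊗ B l`, as an operator on `(ℂ^n)^{⊗ l}`, whose standard orthonormal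
basis is indexed by the tuples `Fin l → n`. -/
def tensor {l : ℕ} {n : Type*} (B : Fin l → Matrix n n ℂ) : Matrix (Fin l → n) (Fin l → n) ℂ :=
  Matrix.of fun x y => ∏ i, B i (x i) (y i)

/-- The partial trace `Tr_{≠ k}` over all tensor factors but the `k`-th. The sum over the tuples `x`
with `x k = s` is a sum over all values of the coordinates different from `k`. -/
def partialTrace {l : ℕ} {n : Type*} [Fintype n] [DecidableEq n] (k : Fin l)
    (X : Matrix (Fin l → n) (Fin l → n) ℂ) : Matrix n n ℂ :=
  Matrix.of fun s t => ∑ x : Fin l → n with x k = s, X x (Function.update x k t)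

/-- The marginal
`A^{(k)}_j = Tr_{≠ k} ((ρ^{⊗ [l] \ k} ⊗ 1_k) ∑_{μ : j_{μ k} = j} A_μ)` of a POVM `A` on
`(ℂ^n)^{⊗ l}`, whose outcome `μ` carries the tuple of guesses `guess μ`. -/
def marginal {l : ℕ} {κ n J : Type*} [Fintype κ] [Fintype n] [DecidableEq n] [DecidableEq J]
    (ρ : Matrix n n ℂ) (A : κ → Matrix (Fin l → n) (Fin l → n) ℂ) (guess : κ → Fin l → J)
    (k : Fin l) (j : J) : Matrix n n ℂ :=
  partialTrace k (tensor (Function.update (fun _ => ρ) k 1) * ∑ μ with guess μ k = j, A μ)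

/-- The outcome probability `λ_j = Tr (ρ a_j)`. -/
def outcomeProb {n J : Type*} [Fintype n] (ρ : Matrix n n ℂ) (a : J → Matrix n n ℂ) (j : J) : ℝ :=
  (ρ * a j).trace.re

/-- `λ_0 = min_j λ_j` (for a finite nonempty `J`). -/
def minProb {n J : Type*} [Fintype n] (ρ : Matrix n n ℂ) (a : J → Matrix n n ℂ) : ℝ :=
  ⨅ j, outcomeProb ρ a j

/-- The state `ρ̂_j = √ρ a_j √ρ / Tr (ρ a_j)` of the canonical ensemble. -/
def canonicalState {n J : Type*} [Fintype n] [DecidableEq n] (ρ : Matrix n n ℂ)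
    (a : J → Matrix n n ℂ) (j : J) : Matrix n n ℂ :=
  (outcomeProb ρ a j)⁻¹ • (msqrt ρ * a j * msqrt ρ)

/-- The entropy defect `H(ρ) - ∑_j λ_j H(ρ̂_j)` of the canonical ensemble. -/
def entropyDefect {n J : Type*} [Fintype n] [DecidableEq n] [Fintype J] (ρ : Matrix n n ℂ)
    (a : J → Matrix n n ℂ) : ℝ :=
  entropy ρ - ∑ j, outcomeProb ρ a j * entropy (canonicalState ρ a j)

end MeasurementCompression

end

/-! The proof is a relative-entropy argument on `ρ^{⊗l}`. Give each guess `j` a positive definite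
reference state `τ_j`, each outcome `μ` the product state `t_μ` of the states its tuple names, and
let `T` be the uniform mixture of the `t_μ`. Klein's inequality bounds `l H(ρ)` by `-Tr ρ^{⊗l} log
T`. Since `T ≥ t_μ / M`, operator monotonicity of the logarithm gives `log T ≥ log t_μ - log M`.
Decomposing `ρ^{⊗l}` into the pieces `√ρ^{⊗l} A_μ √ρ^{⊗l}` and using that `log t_μ` is a sum of
local terms, only the marginals survive, and `log M` is paid once (`entropy_le_logb_card_sub`).

It remains to replace `A^{(k)}_j` by `a_j`. If `τ_j` were `ρ̂_j`, the exact term would be `λ_j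
H(ρ̂_j)`, but `ρ̂_j` may be singular and its logarithm unbounded. So `τ_j` is `ρ̂_j` mixed with
weight `δ` of the maximally mixed state: this costs `-log (1 - δ)` in cross entropy and bounds `-log
τ_j` by `log (d/δ)`, so that Hölder's inequality limits the replacement error to `ε log (d/δ)` per
factor (`mul_entropyDefect_le`). The choice `δ = 2ε/λ₀²` yields the stated error term, which tends
to `0` with `ε`; hence the asymptotic claim. -/

noncomputable section

namespace MeasurementCompression

open scoped MatrixOrder Matrix.Norms.L2Operator

/-! ### Matrix logarithms in diagonalized form and Klein's inequality. -/

section functionalCalculus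

variable {n : Type*} [Fintype n] [DecidableEq n]

/-- The functional calculus of a matrix given with a unitary diagonalization. -/
theorem cfc_conj_diagonal (U : Matrix.unitaryGroup n ℂ) (d : n → ℝ) (f : ℝ → ℝ) :
    cfc f ((U : Matrix n n ℂ) * Matrix.diagonal (fun i => (d i : ℂ)) * star (U : Matrix n n ℂ)) =
      (U : Matrix n n ℂ) * Matrix.diagonal (fun i => (f (d i) : ℂ)) * star (U : Matrix n n ℂ) := by
  -- On the finitely many values of `d`, `f` agrees with a Lagrange interpolant; polynomials commute
  -- with the algebra homomorphism `φ` below, and the spectrum of `φ d` lies among those values.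
  obtain ⟨p, hp⟩ : ∃ p : Polynomial ℝ, ∀ i, p.eval (d i) = f (d i) := by
    refine ⟨Lagrange.interpolate (Finset.univ.image d) id f, fun i => ?_⟩
    exact Lagrange.eval_interpolate_at_node (s := Finset.univ.image d) (v := id) f
      (Set.injOn_id _) (Finset.mem_image_of_mem d (Finset.mem_univ i))
  have hU : star (U : Matrix n n ℂ) * (U : Matrix n n ℂ) = 1 := Unitary.coe_star_mul_self U
  have hU' : (U : Matrix n n ℂ) * star (U : Matrix n n ℂ) = 1 := Unitary.coe_mul_star_self U
  let φ : (n → ℝ) →ₐ[ℝ] Matrix n n ℂ :=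
    { toFun := fun g => (U : Matrix n n ℂ) * Matrix.diagonal (fun i => (g i : ℂ)) *
        star (U : Matrix n n ℂ)
      map_one' := by simp [hU']
      map_zero' := by simp
      map_mul' := fun x y => by
        have : Matrix.diagonal (fun i => ((x * y) i : ℂ)) =
            Matrix.diagonal (fun i => (x i : ℂ)) * Matrix.diagonal (fun i => (y i : ℂ)) := by
          simp [Matrix.diagonal_mul_diagonal]
        rw [this]
        calc _ = (U : Matrix n n ℂ) * Matrix.diagonal (fun i => (x i : ℂ)) * 1 *
              Matrix.diagonal (fun i => (y i : ℂ)) * star (U : Matrix n n ℂ) := by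
              simp only [mul_one, mul_assoc]
          _ = _ := by rw [← hU]; simp only [mul_assoc]
      map_add' := fun x y => by
        have : Matrix.diagonal (fun i => ((x + y) i : ℂ)) =
            Matrix.diagonal (fun i => (x i : ℂ)) + Matrix.diagonal (fun i => (y i : ℂ)) := by
          simp [Matrix.diagonal_add]
        rw [this, mul_add, add_mul]
      commutes' := fun r => by
        have : Matrix.diagonal (fun i : n => ((algebraMap ℝ (n → ℝ) r i : ℝ) : ℂ)) =
            (r : ℂ) • (1 : Matrix n n ℂ) := by
          ext i j; by_cases h : i = j <;> simp [h, Matrix.diagonal]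
        rw [this, mul_smul_comm, smul_mul_assoc, mul_one, hU', Algebra.algebraMap_eq_smul_one]
        ext i j; simp }
  have hφ : ∀ g : n → ℝ, φ g = (U : Matrix n n ℂ) * Matrix.diagonal (fun i => (g i : ℂ)) *
        star (U : Matrix n n ℂ) := fun g => rfl
  have hsa : IsSelfAdjoint (φ d) := by
    rw [hφ, IsSelfAdjoint, star_mul, star_mul, star_star, Matrix.star_eq_conjTranspose
      (Matrix.diagonal _), Matrix.diagonal_conjTranspose, mul_assoc]
    congr 3
    ext i; simp
  have hspec : spectrum ℝ (φ d) ⊆ Set.range d := by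
    refine (AlgHom.spectrum_apply_subset φ d).trans ?_
    rw [Pi.spectrum_eq]
    refine Set.iUnion_subset fun i x hx => ⟨i, ?_⟩
    rw [← Algebra.algebraMap_self_apply (R := ℝ) (d i), spectrum.scalar_eq] at hx
    exact hx.symm
  rw [← hφ d, ← hφ (fun i => f (d i))]
  have h1 : cfc f (φ d) = cfc p.eval (φ d) := by
    refine cfc_congr fun x hx => ?_
    obtain ⟨i, rfl⟩ := hspec hx
    exact (hp i).symm
  rw [h1, cfc_polynomial p (φ d) hsa, Polynomial.aeval_algHom_apply]
  congr 1
  ext i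
  rw [Polynomial.aeval_pi_apply]
  simp [hp i]

theorem _root_.Matrix.PosDef.exists_eq_conj_diagonal {A : Matrix n n ℂ} (hA : A.PosDef) :
    ∃ (U : Matrix.unitaryGroup n ℂ) (d : n → ℝ), (∀ i, 0 < d i) ∧
      A = (U : Matrix n n ℂ) * Matrix.diagonal (fun i => (d i : ℂ)) * star (U : Matrix n n ℂ) := by
  refine ⟨hA.isHermitian.eigenvectorUnitary, hA.isHermitian.eigenvalues, hA.eigenvalues_pos, ?_⟩
  conv_lhs => rw [hA.isHermitian.spectral_theorem]
  rfl

/-- The operator logarithm to base `2` is monotone. -/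
theorem cfc_logb_mono {S T : Matrix n n ℂ} (hS : S.PosDef) (hST : S ≤ T) :
    cfc (Real.logb 2) S ≤ cfc (Real.logb 2) T := by
  have key : ∀ X : Matrix n n ℂ, cfc (Real.logb 2) X = (Real.log 2)⁻¹ • CFC.log X := by
    intro X
    rw [CFC.log, ← cfc_smul (hf := X.finite_real_spectrum.continuousOn _)]
    congr 1; ext x; simp [Real.logb, div_eq_inv_mul]
  rw [key, key]
  have h2 : 0 ≤ (Real.log 2)⁻¹ := inv_nonneg.2 (Real.log_nonneg (by norm_num))
  exact smul_le_smul_of_nonneg_left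
    (CFC.log_le_log hST (Matrix.isStrictlyPositive_iff_posDef.2 hS)) h2

/-- All eigenvalues must be positive here: with `log 0 = 0` the rule `log (c x) = log c + log x`
fails at `x = 0`. -/
theorem cfc_logb_smul {T : Matrix n n ℂ} (hT : T.PosDef) {c : ℝ} (hc : 0 < c) :
    cfc (Real.logb 2) (c • T) = (Real.logb 2 c) • (1 : Matrix n n ℂ) + cfc (Real.logb 2) T := by
  obtain ⟨U, d, hd, rfl⟩ := hT.exists_eq_conj_diagonal
  have h1 : c • ((U : Matrix n n ℂ) * Matrix.diagonal (fun i => (d i : ℂ)) *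
      star (U : Matrix n n ℂ)) = (U : Matrix n n ℂ) * Matrix.diagonal
        (fun i => ((c * d i : ℝ) : ℂ)) * star (U : Matrix n n ℂ) := by
    rw [← smul_mul_assoc, ← mul_smul_comm]
    congr 2
    ext i j; by_cases h : i = j <;> simp [h, Matrix.diagonal]
  have h2 : (Real.logb 2 c) • (1 : Matrix n n ℂ) = (U : Matrix n n ℂ) * Matrix.diagonal
        (fun _ => ((Real.logb 2 c : ℝ) : ℂ)) * star (U : Matrix n n ℂ) := by
    have : Matrix.diagonal (fun _ : n => ((Real.logb 2 c : ℝ) : ℂ)) = (Real.logb 2 c) • 1 := by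
      ext i j; by_cases h : i = j <;> simp [h, Matrix.diagonal]
    rw [this, mul_smul_comm, smul_mul_assoc, mul_one,
      Unitary.mul_star_self_of_mem U.2]
  rw [h1, cfc_conj_diagonal, cfc_conj_diagonal, h2, ← add_mul, ← mul_add, Matrix.diagonal_add]
  congr 3
  ext i
  rw [Real.logb_mul hc.ne' (hd i).ne']
  push_cast; rfl

/-- The trace of a product of two diagonalized matrices. -/
theorem trace_conj_diagonal_mul_conj_diagonal (U V : Matrix.unitaryGroup n ℂ) (r t : n → ℝ) :
    (((U : Matrix n n ℂ) * Matrix.diagonal (fun i => (r i : ℂ)) * star (U : Matrix n n ℂ)) *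
      ((V : Matrix n n ℂ) * Matrix.diagonal (fun i => (t i : ℂ)) * star (V : Matrix n n ℂ))).trace.re
      = ∑ i, ∑ j, Complex.normSq ((star (U : Matrix n n ℂ) * (V : Matrix n n ℂ)) i j) *
          (r i * t j) := by
  set W := star (U : Matrix n n ℂ) * (V : Matrix n n ℂ) with hW
  have hWs : star (V : Matrix n n ℂ) * (U : Matrix n n ℂ) = star W := by
    rw [hW, star_mul, star_star]
  have : (((U : Matrix n n ℂ) * Matrix.diagonal (fun i => (r i : ℂ)) * star (U : Matrix n n ℂ)) *
      ((V : Matrix n n ℂ) * Matrix.diagonal (fun i => (t i : ℂ)) * star (V : Matrix n n ℂ))).trace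
      = (Matrix.diagonal (fun i => (r i : ℂ)) * W * Matrix.diagonal (fun i => (t i : ℂ)) *
        star W).trace := by
    rw [← hWs, hW]
    simp only [mul_assoc]
    rw [Matrix.trace_mul_comm]
    simp only [mul_assoc]
  rw [this, Matrix.trace, Complex.re_sum]
  refine Finset.sum_congr rfl fun i _ => ?_
  rw [Matrix.diag_apply, Matrix.mul_apply, Complex.re_sum]
  refine Finset.sum_congr rfl fun j _ => ?_
  rw [Matrix.mul_diagonal, Matrix.diagonal_mul, Matrix.star_apply]
  have : (r i : ℂ) * W i j * (t j : ℂ) * star (W i j) =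
      ((Complex.normSq (W i j) * (r i * t j) : ℝ) : ℂ) := by
    push_cast
    rw [← Complex.mul_conj]
    simp only [Complex.star_def]; ring
  rw [this, Complex.ofReal_re]

theorem sum_normSq_row (W : Matrix n n ℂ) (hW : W * star W = 1) (i : n) :
    ∑ j, Complex.normSq (W i j) = 1 := by
  have := congrFun (congrFun hW i) i
  rw [Matrix.mul_apply, Matrix.one_apply_eq] at this
  have h2 := congrArg Complex.re this
  rw [Complex.re_sum] at h2
  simpa [Matrix.star_apply, Complex.mul_conj] using h2

/-- Klein's inequality: the relative entropy of two positive definite matrices of equal trace is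
nonnegative. -/
theorem trace_mul_logb_le {R T : Matrix n n ℂ} (hR : R.PosDef) (hT : T.PosDef)
    (htr : R.trace = T.trace) :
    (R * cfc (Real.logb 2) T).trace.re ≤ (R * cfc (Real.logb 2) R).trace.re := by
  obtain ⟨U, r, hr, rfl⟩ := hR.exists_eq_conj_diagonal
  obtain ⟨V, t, ht, rfl⟩ := hT.exists_eq_conj_diagonal
  have htr' : ∑ i, r i = ∑ i, t i := by
    have hc : ∀ (U : Matrix.unitaryGroup n ℂ) (r : n → ℝ), ((U : Matrix n n ℂ) * Matrix.diagonal
        (fun i => (r i : ℂ)) * star (U : Matrix n n ℂ)).trace = ((∑ i, r i : ℝ) : ℂ) := by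
      intro U r
      rw [Matrix.trace_mul_comm, ← mul_assoc, Unitary.coe_star_mul_self, one_mul,
        Matrix.trace_diagonal]
      push_cast; rfl
    rw [hc, hc] at htr
    exact_mod_cast htr
  rw [cfc_conj_diagonal, cfc_conj_diagonal, trace_conj_diagonal_mul_conj_diagonal,
    trace_conj_diagonal_mul_conj_diagonal]
  -- The overlap matrix `W` of the two eigenbases is unitary, so the weights `|W i j|²` are doubly
  -- stochastic and the claim reduces to an average of scalar inequalities.
  set W := star (U : Matrix n n ℂ) * (V : Matrix n n ℂ) with hW
  have hWW : W * star W = 1 := by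
    rw [hW, star_mul, star_star]
    calc _ = star (U : Matrix n n ℂ) * ((V : Matrix n n ℂ) * star (V : Matrix n n ℂ)) * U := by
          simp only [mul_assoc]
      _ = 1 := by simp
  have hWW' : star W * star (star W) = 1 := by
    rw [star_star]; exact mul_eq_one_comm.1 hWW
  have hrow := sum_normSq_row W hWW
  have hcol : ∀ j, ∑ i, Complex.normSq (W i j) = 1 := by
    intro j
    have := sum_normSq_row (star W) hWW' j
    simpa [Matrix.star_apply, Complex.normSq_conj] using this
  have hRR : ∑ i, ∑ j, Complex.normSq ((star (U : Matrix n n ℂ) * (U : Matrix n n ℂ)) i j) *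
      (r i * Real.logb 2 (r j)) = ∑ i, ∑ j, Complex.normSq (W i j) * (r i * Real.logb 2 (r i)) := by
    refine Finset.sum_congr rfl fun i _ => ?_
    rw [← Finset.sum_mul, hrow, one_mul, Unitary.coe_star_mul_self,
      Finset.sum_eq_single i (fun j _ hj => by simp [Matrix.one_apply_ne hj.symm]) (by simp)]
    simp
  rw [hRR]
  have hl2 : 0 < Real.log 2 := Real.log_pos (by norm_num)
  -- This is `log x ≤ x - 1` at `x = t j / r i`. The linear remainder averages to zero in `hsum`
  -- because the traces agree.
  have hpt : ∀ i j, r i * Real.logb 2 (t j) ≤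
      r i * Real.logb 2 (r i) + (Real.log 2)⁻¹ * (t j - r i) := by
    intro i j
    have h1 := Real.log_le_sub_one_of_pos (div_pos (ht j) (hr i))
    rw [Real.log_div (ht j).ne' (hr i).ne'] at h1
    have h2 := mul_le_mul_of_nonneg_left h1 (hr i).le
    have h3 : r i * (t j / r i - 1) = t j - r i := by
      have := (hr i).ne'
      field_simp
    rw [h3] at h2
    have h4 := mul_le_mul_of_nonneg_left h2 (inv_nonneg.2 hl2.le)
    rw [Real.logb, Real.logb, div_eq_inv_mul, div_eq_inv_mul]
    linarith
  have hsum : ∑ i, ∑ j, Complex.normSq (W i j) * ((Real.log 2)⁻¹ * (t j - r i)) = 0 := by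
    have e1 : ∑ i, ∑ j, Complex.normSq (W i j) * t j = ∑ j, t j := by
      rw [Finset.sum_comm]
      exact Finset.sum_congr rfl fun j _ => by rw [← Finset.sum_mul, hcol, one_mul]
    have e2 : ∑ i, ∑ j, Complex.normSq (W i j) * r i = ∑ i, r i :=
      Finset.sum_congr rfl fun i _ => by rw [← Finset.sum_mul, hrow, one_mul]
    have : ∀ i j, Complex.normSq (W i j) * ((Real.log 2)⁻¹ * (t j - r i)) =
        (Real.log 2)⁻¹ * (Complex.normSq (W i j) * t j - Complex.normSq (W i j) * r i) := by
      intros; ring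
    simp only [this, ← Finset.mul_sum, Finset.sum_sub_distrib, e1, e2, htr', sub_self, mul_zero]
  calc _ ≤ ∑ i, ∑ j, (Complex.normSq (W i j) * (r i * Real.logb 2 (r i)) +
        Complex.normSq (W i j) * ((Real.log 2)⁻¹ * (t j - r i))) := by
        refine Finset.sum_le_sum fun i _ => Finset.sum_le_sum fun j _ => ?_
        rw [← mul_add]
        exact mul_le_mul_of_nonneg_left (hpt i j) (Complex.normSq_nonneg _)
    _ = _ := by simp only [Finset.sum_add_distrib, hsum, add_zero]

end functionalCalculus

/-! ### Tensor products, partial traces and a Hölder inequality. -/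

section tensorPower

variable {l : ℕ} {n : Type*}

theorem tensor_conjTranspose (B : Fin l → Matrix n n ℂ) :
    (tensor B)ᴴ = tensor fun i => (B i)ᴴ := by
  ext x y
  simp [tensor, Matrix.conjTranspose_apply]

theorem tensor_mul [Fintype n] (B C : Fin l → Matrix n n ℂ) :
    tensor B * tensor C = tensor fun i => B i * C i := by
  ext x y
  simp only [Matrix.mul_apply, tensor, Matrix.of_apply, ← Finset.prod_mul_distrib]
  rw [Finset.prod_univ_sum, Fintype.piFinset_univ]

theorem trace_tensor [Fintype n] (B : Fin l → Matrix n n ℂ) :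
    (tensor B).trace = ∏ i, (B i).trace := by
  simp only [Matrix.trace, Matrix.diag_apply, tensor, Matrix.of_apply]
  rw [Finset.prod_univ_sum, Fintype.piFinset_univ]

theorem trace_tensor_update [Fintype n] {ρ : Matrix n n ℂ} (hρ : ρ.trace = 1) (k : Fin l) (Z : Matrix n n ℂ) :
    (tensor (Function.update (fun _ => ρ) k Z)).trace = Z.trace := by
  rw [trace_tensor, Finset.prod_eq_single k]
  · simp
  · intro i _ hi
    rw [Function.update_of_ne hi, hρ]
  · simp

variable [DecidableEq n]

theorem tensor_diagonal (d : Fin l → n → ℂ) :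
    tensor (fun i => Matrix.diagonal (d i)) = Matrix.diagonal fun x => ∏ i, d i (x i) := by
  ext x y
  by_cases h : x = y
  · subst h; simp [tensor]
  · obtain ⟨i, hi⟩ := Function.ne_iff.1 h
    rw [Matrix.diagonal_apply_ne _ h]
    exact Finset.prod_eq_zero (Finset.mem_univ i) (Matrix.diagonal_apply_ne _ hi)

theorem tensor_one : tensor (fun _ : Fin l => (1 : Matrix n n ℂ)) = 1 := by
  have := tensor_diagonal (l := l) (n := n) (fun _ _ => 1)
  simpa using this

variable [Fintype n]

/-- The tensor product of unitary matrices. -/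
def tensorUnitary (U : Fin l → Matrix.unitaryGroup n ℂ) : Matrix.unitaryGroup (Fin l → n) ℂ :=
  ⟨tensor fun i => (U i : Matrix n n ℂ), by
    rw [Matrix.mem_unitaryGroup_iff, Matrix.star_eq_conjTranspose, tensor_conjTranspose, tensor_mul]
    simp only [← Matrix.star_eq_conjTranspose, Unitary.mul_star_self_of_mem (U _).2, tensor_one]⟩

theorem tensor_conj (U : Fin l → Matrix.unitaryGroup n ℂ) (B : Fin l → Matrix n n ℂ) :
    tensor (fun i => (U i : Matrix n n ℂ) * B i * star (U i : Matrix n n ℂ)) =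
      (tensorUnitary U : Matrix (Fin l → n) (Fin l → n) ℂ) * tensor B *
        star (tensorUnitary U : Matrix (Fin l → n) (Fin l → n) ℂ) := by
  have : star (tensorUnitary U : Matrix (Fin l → n) (Fin l → n) ℂ) =
      tensor fun i => star (U i : Matrix n n ℂ) := by
    rw [Matrix.star_eq_conjTranspose, tensorUnitary, tensor_conjTranspose]; rfl
  rw [this, tensorUnitary, tensor_mul, tensor_mul]

theorem tensor_conj_diagonal (U : Fin l → Matrix.unitaryGroup n ℂ) (d : Fin l → n → ℝ) :
    tensor (fun i => (U i : Matrix n n ℂ) * Matrix.diagonal (fun s => (d i s : ℂ)) *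
        star (U i : Matrix n n ℂ)) =
      (tensorUnitary U : Matrix (Fin l → n) (Fin l → n) ℂ) *
        Matrix.diagonal (fun x => ((∏ i, d i (x i) : ℝ) : ℂ)) *
        star (tensorUnitary U : Matrix (Fin l → n) (Fin l → n) ℂ) := by
  rw [tensor_conj, tensor_diagonal]
  push_cast; rfl

theorem posDef_tensor {B : Fin l → Matrix n n ℂ} (hB : ∀ i, (B i).PosDef) : (tensor B).PosDef := by
  choose U d hd hU using fun i => (hB i).exists_eq_conj_diagonal
  obtain rfl : B = fun i => (U i : Matrix n n ℂ) * Matrix.diagonal (fun s => (d i s : ℂ)) *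
        star (U i : Matrix n n ℂ) := funext hU
  have hunit : IsUnit (tensorUnitary U : Matrix (Fin l → n) (Fin l → n) ℂ) :=
    (Unitary.toUnits (tensorUnitary U)).isUnit
  rw [tensor_conj_diagonal, Matrix.IsUnit.posDef_star_right_conjugate_iff hunit]
  refine Matrix.PosDef.diagonal fun x => ?_
  exact_mod_cast Finset.prod_pos fun i _ => hd i (x i)

/-- The logarithm of a tensor product is the sum of the local logarithms. -/
theorem cfc_logb_tensor {B : Fin l → Matrix n n ℂ} (hB : ∀ i, (B i).PosDef) :
    cfc (Real.logb 2) (tensor B) =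
      ∑ k, tensor (Function.update (fun _ => 1) k (cfc (Real.logb 2) (B k))) := by
  choose U d hd hU using fun i => (hB i).exists_eq_conj_diagonal
  obtain rfl : B = fun i => (U i : Matrix n n ℂ) * Matrix.diagonal (fun s => (d i s : ℂ)) *
        star (U i : Matrix n n ℂ) := funext hU
  rw [tensor_conj_diagonal, cfc_conj_diagonal]
  have hk : ∀ k, tensor (Function.update (fun _ => 1) k (cfc (Real.logb 2)
      ((U k : Matrix n n ℂ) * Matrix.diagonal (fun s => (d k s : ℂ)) *
        star (U k : Matrix n n ℂ)))) = (tensorUnitary U : Matrix (Fin l → n) (Fin l → n) ℂ) *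
        Matrix.diagonal (fun x => ((Real.logb 2 (d k (x k)) : ℝ) : ℂ)) *
        star (tensorUnitary U : Matrix (Fin l → n) (Fin l → n) ℂ) := by
    intro k
    -- Writing each identity factor as `U i * 1 * star (U i)` lets one product unitary diagonalize
    -- every summand.
    have e1 : (Function.update (fun _ : Fin l => (1 : Matrix n n ℂ)) k (cfc (Real.logb 2)
        ((U k : Matrix n n ℂ) * Matrix.diagonal (fun s => (d k s : ℂ)) *
        star (U k : Matrix n n ℂ)))) = fun i => (U i : Matrix n n ℂ) *
          Matrix.diagonal (fun s => if i = k then ((Real.logb 2 (d k s) : ℝ) : ℂ) else 1) *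
          star (U i : Matrix n n ℂ) := by
      funext i
      by_cases h : i = k
      · subst h
        rw [Function.update_self, cfc_conj_diagonal]; simp
      · rw [Function.update_of_ne h]
        simp [h, Unitary.mul_star_self_of_mem (U i).2]
    rw [e1, tensor_conj, tensor_diagonal]
    congr 3
    funext x
    rw [Finset.prod_ite_eq' Finset.univ k (fun i => ((Real.logb 2 (d k (x i)) : ℝ) : ℂ))]
    simp
  simp only [hk]
  rw [← Finset.sum_mul, ← Finset.mul_sum]
  congr 2
  ext x y
  by_cases h : x = y
  · subst h
    rw [Matrix.sum_apply]
    simp only [Matrix.diagonal_apply_eq]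
    rw [Real.logb_prod _ _ fun i _ => (hd i (x i)).ne']
    push_cast; rfl
  · rw [Matrix.sum_apply]
    simp [h]

/-- The partial trace is adjoint to the embedding of an operator at the `k`-th tensor factor. -/
theorem trace_partialTrace_mul (k : Fin l) (B : Matrix (Fin l → n) (Fin l → n) ℂ)
    (Z : Matrix n n ℂ) :
    (partialTrace k B * Z).trace = (B * tensor (Function.update (fun _ => 1) k Z)).trace := by
  have hR : ∀ x, (B * tensor (Function.update (fun _ => 1) k Z)) x x =
      ∑ t, B x (Function.update x k t) * Z t (x k) := by
    intro x
    rw [Matrix.mul_apply]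
    symm
    -- Only tuples agreeing with `x` off the coordinate `k` contribute, since the other factors are
    -- identities.
    refine Finset.sum_of_injOn (Function.update x k) ?_ (fun _ _ => Finset.mem_univ _) ?_ ?_
    · exact (Function.update_injective x k).injOn
    · intro y _ hy
      obtain ⟨i, hik, hi⟩ : ∃ i, i ≠ k ∧ y i ≠ x i := by
        by_contra! h
        refine hy ⟨y k, by simp, ?_⟩
        funext i
        by_cases hi : i = k
        · subst hi; simp
        · rw [Function.update_of_ne hi, h i hi]
      have : tensor (Function.update (fun _ => 1) k Z) y x = 0 :=
        Finset.prod_eq_zero (Finset.mem_univ i) (by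
          rw [Function.update_of_ne hik, Matrix.one_apply_ne hi])
      rw [this, mul_zero]
    · intro t _
      congr 1
      rw [tensor, Matrix.of_apply, Finset.prod_eq_single k]
      · simp
      · intro i _ hi
        rw [Function.update_of_ne hi, Function.update_of_ne hi, Matrix.one_apply_eq]
      · simp
  simp only [Matrix.trace, Matrix.diag_apply, hR]
  rw [← Finset.sum_fiberwise Finset.univ (fun x : Fin l → n => x k)]
  refine Finset.sum_congr rfl fun s _ => ?_
  simp only [Matrix.mul_apply, partialTrace, Matrix.of_apply, Finset.sum_mul]
  rw [Finset.sum_comm]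
  refine Finset.sum_congr rfl fun x hx => ?_
  rw [(Finset.mem_filter.1 hx).2]

/-- Hölder's inequality for the operator norm and the trace norm of a positive matrix. -/
theorem abs_trace_mul_le (D : Matrix n n ℂ) {N : Matrix n n ℂ} (hN : N.PosSemidef) :
    |(D * N).trace.re| ≤ opNorm D * N.trace.re := by
  obtain ⟨B, rfl⟩ := CStarAlgebra.nonneg_iff_eq_star_mul_self.1 hN.nonneg
  -- With `N = B* B`, the conjugated rows `v i` of `B` give `Tr (X N) = ∑ ⟨v i, X (v i)⟩`; taking `X
  -- = 1` recovers `Tr N`.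
  let v : n → EuclideanSpace ℂ n := fun i => WithLp.toLp 2 (fun s => star (B i s))
  have hv : ∀ i (X : Matrix n n ℂ), (B * X * star B) i i =
      inner ℂ (v i) (Matrix.toEuclideanCLM (n := n) (𝕜 := ℂ) X (v i)) := by
    intro i X
    rw [PiLp.inner_apply, mul_assoc, Matrix.mul_apply]
    refine Finset.sum_congr rfl fun s _ => ?_
    rw [Matrix.ofLp_toEuclideanCLM, Matrix.mul_apply]
    simp [v, Matrix.mulVec, dotProduct, mul_comm]
  have htr : ∀ X : Matrix n n ℂ, (X * (star B * B)).trace.re =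
      ∑ i, (inner ℂ (v i) (Matrix.toEuclideanCLM (n := n) (𝕜 := ℂ) X (v i))).re := by
    intro X
    rw [← mul_assoc, Matrix.trace_mul_comm, ← mul_assoc, Matrix.trace, Complex.re_sum]
    simp only [Matrix.diag_apply, hv]
  have h1 := htr 1
  rw [one_mul] at h1
  rw [htr, h1, Finset.mul_sum]
  refine (Finset.abs_sum_le_sum_abs _ _).trans (Finset.sum_le_sum fun i _ => ?_)
  rw [map_one, one_apply_eq_self]
  have h3 : (inner ℂ (v i) (v i)).re = ‖v i‖ * ‖v i‖ :=
    inner_self_eq_norm_mul_norm (𝕜 := ℂ) (v i)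
  rw [h3]
  calc _ ≤ ‖inner ℂ (v i) (Matrix.toEuclideanCLM (n := n) (𝕜 := ℂ) D (v i))‖ :=
        Complex.abs_re_le_norm _
    _ ≤ ‖v i‖ * ‖Matrix.toEuclideanCLM (n := n) (𝕜 := ℂ) D (v i)‖ := norm_inner_le_norm _ _
    _ ≤ ‖v i‖ * (opNorm D * ‖v i‖) := by
        gcongr
        exact ContinuousLinearMap.le_opNorm _ _
    _ = _ := by ring

end tensorPower

/-! ### Bounding the entropy by the number of outcomes and a cross entropy. -/

section crossEntropy

variable {n : Type*} [Fintype n] [DecidableEq n]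

theorem re_trace_mul_nonneg {A N : Matrix n n ℂ} (hA : A.PosSemidef) (hN : N.PosSemidef) :
    0 ≤ (A * N).trace.re := by
  obtain ⟨B, rfl⟩ := CStarAlgebra.nonneg_iff_eq_star_mul_self.1 hA.nonneg
  rw [mul_assoc, Matrix.trace_mul_comm]
  exact (Complex.nonneg_iff.1 (hN.mul_mul_conjTranspose_same B).trace_nonneg).1

theorem isHermitian_msqrt (ρ : Matrix n n ℂ) : (msqrt ρ)ᴴ = msqrt ρ :=
  cfc_predicate (R := ℝ) (p := IsSelfAdjoint) Real.sqrt ρ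

theorem msqrt_mul_msqrt {ρ : Matrix n n ℂ} (hρ : ρ.PosSemidef) : msqrt ρ * msqrt ρ = ρ := by
  rw [msqrt, ← cfc_mul (hf := ρ.finite_real_spectrum.continuousOn _)
    (hg := ρ.finite_real_spectrum.continuousOn _)]
  conv_rhs => rw [← cfc_id ℝ ρ hρ.isHermitian]
  refine cfc_congr fun x hx => ?_
  exact Real.mul_self_sqrt (spectrum_nonneg_of_nonneg hρ.nonneg hx)

theorem posSemidef_msqrt_conj (ρ : Matrix n n ℂ) {N : Matrix n n ℂ} (hN : N.PosSemidef) :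
    (msqrt ρ * N * msqrt ρ).PosSemidef := by
  have := hN.mul_mul_conjTranspose_same (msqrt ρ)
  rwa [isHermitian_msqrt] at this

variable {l : ℕ}

/-- For `S = √ρ` the idle identity factors become `ρ`, which is exactly the weight `ρ^{⊗[l] \ k}` in
the definition of the marginals. -/
theorem tensor_conj_update (S : Matrix n n ℂ) (k : Fin l) (Z : Matrix n n ℂ) :
    tensor (fun _ => S) * tensor (Function.update (fun _ => 1) k Z) * tensor (fun _ => S) =
      tensor (Function.update (fun _ => S * S) k (S * Z * S)) := by
  rw [tensor_mul, tensor_mul]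
  congr 1
  funext i
  by_cases h : i = k
  · subst h; simp
  · simp [Function.update_of_ne h]

/-- The von Neumann entropy is additive on tensor powers. -/
theorem entropy_tensor {ρ : Matrix n n ℂ} (hρ : ρ.PosDef) (hρ_tr : ρ.trace = 1) :
    entropy (tensor fun _ : Fin l => ρ) = l * entropy ρ := by
  have h : ∀ k : Fin l, (tensor (fun _ => ρ) * tensor (Function.update (fun _ => 1) k
      (cfc (Real.logb 2) ρ))).trace = (ρ * cfc (Real.logb 2) ρ).trace := by
    intro k
    rw [← trace_tensor_update hρ_tr k, tensor_mul]
    congr 2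
    funext i
    by_cases h : i = k
    · subst h; simp
    · simp [Function.update_of_ne h]
  rw [entropy, entropy, cfc_logb_tensor fun _ => hρ, Finset.mul_sum, Matrix.trace_sum]
  simp [h]

variable {κ J : Type*} [Fintype κ] [Fintype J] [DecidableEq J]

/-- Pairing the marginals with local observables is pairing the POVM with their extensions. -/
theorem sum_trace_marginal_mul (ρ : Matrix n n ℂ) (A : κ → Matrix (Fin l → n) (Fin l → n) ℂ)
    (guess : κ → Fin l → J) (k : Fin l) (Z : J → Matrix n n ℂ) :
    ∑ j, (marginal ρ A guess k j * Z j).trace =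
      ∑ μ, (A μ * tensor (Function.update (fun _ => ρ) k (Z (guess μ k)))).trace := by
  rw [← Finset.sum_fiberwise Finset.univ (fun μ => guess μ k)]
  refine Finset.sum_congr rfl fun j _ => ?_
  have h : tensor (Function.update (fun _ : Fin l => (1 : Matrix n n ℂ)) k (Z j)) *
      tensor (Function.update (fun _ => ρ) k 1) = tensor (Function.update (fun _ => ρ) k (Z j)) := by
    rw [tensor_mul]
    congr 1
    funext i
    by_cases h : i = k
    · subst h; simp
    · simp [Function.update_of_ne h]
  rw [marginal, trace_partialTrace_mul, mul_assoc, Matrix.trace_mul_comm, mul_assoc, h,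
    Finset.sum_mul, Matrix.trace_sum]
  refine Finset.sum_congr rfl fun μ hμ => ?_
  rw [(Finset.mem_filter.1 hμ).2]

/-- The number of outcomes of a POVM bounds the entropy, in terms of the cross entropy of the
marginals with arbitrary reference states `τ j`. -/
theorem entropy_le_logb_card_sub [Nonempty κ] {ρ : Matrix n n ℂ} (hρ : ρ.PosDef)
    (hρ_tr : ρ.trace = 1) {A : κ → Matrix (Fin l → n) (Fin l → n) ℂ} (hA : IsPOVM A)
    (guess : κ → Fin l → J) {τ : J → Matrix n n ℂ} (hτ : ∀ j, (τ j).PosDef)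
    (hτ_tr : ∀ j, (τ j).trace = 1) :
    l * entropy ρ ≤ Real.logb 2 (Fintype.card κ) - ∑ k, ∑ j, (marginal ρ A guess k j *
      (msqrt ρ * cfc (Real.logb 2) (τ j) * msqrt ρ)).trace.re := by
  have hM : (0 : ℝ) < Fintype.card κ := by exact_mod_cast Fintype.card_pos
  set M : ℝ := (Fintype.card κ : ℝ) with hMdef
  set R : Matrix (Fin l → n) (Fin l → n) ℂ := tensor fun _ => ρ with hR
  set Q : Matrix (Fin l → n) (Fin l → n) ℂ := tensor fun _ => msqrt ρ with hQ
  have hQQ : Q * Q = R := by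
    rw [hQ, tensor_mul]; simp only [msqrt_mul_msqrt hρ.posSemidef]; rfl
  have hQs : Qᴴ = Q := by
    rw [hQ, tensor_conjTranspose]; simp only [isHermitian_msqrt]
  have hRtr : R.trace = 1 := by rw [hR, trace_tensor]; simp [hρ_tr]
  let t : κ → Matrix (Fin l → n) (Fin l → n) ℂ := fun μ => tensor fun k => τ (guess μ k)
  have ht : ∀ μ, (t μ).PosDef := fun μ => posDef_tensor fun k => hτ _
  have htM : ∀ μ, (M⁻¹ • t μ).PosDef := fun μ => (ht μ).smul (inv_pos.2 hM)
  set T := ∑ μ, M⁻¹ • t μ with hT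
  have hTpos : T.PosDef := Matrix.posDef_sum Finset.univ_nonempty fun μ _ => htM μ
  have hTtr : T.trace = 1 := by
    rw [hT, Matrix.trace_sum]
    have : ∀ μ, (M⁻¹ • t μ).trace = ((M⁻¹ : ℝ) : ℂ) := by
      intro μ
      rw [Matrix.trace_smul, trace_tensor]
      simp [hτ_tr]
    simp only [this]
    rw [Finset.sum_const, Finset.card_univ, nsmul_eq_mul, ← Complex.ofReal_natCast,
      ← Complex.ofReal_mul, ← hMdef, mul_inv_cancel₀ hM.ne', Complex.ofReal_one]
  have hle : ∀ μ, M⁻¹ • t μ ≤ T := fun μ =>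
    Finset.single_le_sum (f := fun μ => M⁻¹ • t μ) (fun ν _ => (htM ν).posSemidef.nonneg)
      (Finset.mem_univ μ)
  have hklein := trace_mul_logb_le (posDef_tensor fun _ : Fin l => hρ) hTpos (hRtr.trans hTtr.symm)
  have hent := entropy_tensor (l := l) hρ hρ_tr
  rw [entropy] at hent
  -- Since the `A μ` sum to `1`, the operators `Q * A μ * Q` decompose `R`.
  have hswap : ∀ X : Matrix (Fin l → n) (Fin l → n) ℂ,
      (R * X).trace.re = ∑ μ, (A μ * (Q * X * Q)).trace.re := by
    intro X
    rw [← Complex.re_sum, ← Matrix.trace_sum, ← Finset.sum_mul, hA.sum_eq_one, one_mul,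
      Matrix.trace_mul_comm (Q * X), ← mul_assoc, hQQ]
  -- Operator monotonicity applied to `M⁻¹ • t μ ≤ T`. The coefficients of `log M` sum over `μ` to
  -- `Tr R = 1`.
  have hterm : ∀ μ, (A μ * (Q * cfc (Real.logb 2) (t μ) * Q)).trace.re -
      Real.logb 2 M * (A μ * (Q * 1 * Q)).trace.re ≤
      (A μ * (Q * cfc (Real.logb 2) T * Q)).trace.re := by
    intro μ
    have h1 := cfc_logb_mono (htM μ) (hle μ)
    rw [cfc_logb_smul (ht μ) (inv_pos.2 hM), Real.logb_inv] at h1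
    have h2 := re_trace_mul_nonneg (hA.posSemidef μ)
      ((Matrix.le_iff.1 h1).mul_mul_conjTranspose_same Q)
    rw [hQs, mul_sub, mul_add, sub_mul, add_mul, mul_sub, mul_add, Matrix.trace_sub,
      Matrix.trace_add, mul_smul_comm, smul_mul_assoc, mul_smul_comm, Matrix.trace_smul] at h2
    simp only [Complex.sub_re, Complex.add_re, Complex.real_smul, Complex.re_ofReal_mul] at h2
    linarith
  have hmarg : ∑ k, ∑ j, (marginal ρ A guess k j *
      (msqrt ρ * cfc (Real.logb 2) (τ j) * msqrt ρ)).trace.re =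
      ∑ μ, (A μ * (Q * cfc (Real.logb 2) (t μ) * Q)).trace.re := by
    have e1 : ∀ μ, (A μ * (Q * cfc (Real.logb 2) (t μ) * Q)).trace.re = ∑ k, (A μ * tensor
        (Function.update (fun _ => ρ) k
          (msqrt ρ * cfc (Real.logb 2) (τ (guess μ k)) * msqrt ρ))).trace.re := by
      intro μ
      rw [cfc_logb_tensor fun k => hτ (guess μ k), Finset.mul_sum, Finset.sum_mul, Finset.mul_sum,
        Matrix.trace_sum, Complex.re_sum]
      simp only [hQ, tensor_conj_update, msqrt_mul_msqrt hρ.posSemidef]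
    simp only [e1]
    conv_rhs => rw [Finset.sum_comm]
    refine Finset.sum_congr rfl fun k _ => ?_
    simp only [← Complex.re_sum]
    rw [sum_trace_marginal_mul ρ A guess k
      (fun j => msqrt ρ * cfc (Real.logb 2) (τ j) * msqrt ρ)]
  have hsum := Finset.sum_le_sum (s := Finset.univ) fun μ _ => hterm μ
  rw [Finset.sum_sub_distrib, ← Finset.mul_sum, ← hswap, ← hswap, ← hmarg, mul_one, hRtr,
    Complex.one_re, mul_one] at hsum
  linarith

/-! ### Smoothed reference states. -/

/-- The mixture of a state with the maximally mixed state. -/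
def smoothing (δ : ℝ) (σ : Matrix n n ℂ) : Matrix n n ℂ :=
  (1 - δ) • σ + (δ / Fintype.card n) • 1

section smoothing

variable {σ : Matrix n n ℂ} {δ : ℝ}

theorem exists_diagonalization_state (hσ : σ.PosSemidef) (hσ_tr : σ.trace = 1) :
    ∃ (U : Matrix.unitaryGroup n ℂ) (p : n → ℝ), (∀ i, 0 ≤ p i) ∧ (∀ i, p i ≤ 1) ∧ ∑ i, p i = 1 ∧
      σ = (U : Matrix n n ℂ) * Matrix.diagonal (fun i => (p i : ℂ)) * star (U : Matrix n n ℂ) := by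
  have h1 : ∑ i, hσ.isHermitian.eigenvalues i = 1 := by
    have := hσ.isHermitian.trace_eq_sum_eigenvalues
    rw [hσ_tr] at this
    simpa using (congrArg Complex.re this).symm
  refine ⟨hσ.isHermitian.eigenvectorUnitary, hσ.isHermitian.eigenvalues, hσ.eigenvalues_nonneg,
    fun i => ?_, h1, ?_⟩
  · rw [← h1]
    exact Finset.single_le_sum (fun j _ => hσ.eigenvalues_nonneg j) (Finset.mem_univ i)
  · conv_lhs => rw [hσ.isHermitian.spectral_theorem]
    rfl

theorem smoothing_conj_diagonal (U : Matrix.unitaryGroup n ℂ) (p : n → ℝ) :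
    smoothing δ ((U : Matrix n n ℂ) * Matrix.diagonal (fun i => (p i : ℂ)) *
      star (U : Matrix n n ℂ)) = (U : Matrix n n ℂ) * Matrix.diagonal
        (fun i => (((1 - δ) * p i + δ / Fintype.card n : ℝ) : ℂ)) * star (U : Matrix n n ℂ) := by
  have h : Matrix.diagonal (fun i => (((1 - δ) * p i + δ / Fintype.card n : ℝ) : ℂ)) =
      (1 - δ) • Matrix.diagonal (fun i => (p i : ℂ)) +
        (δ / Fintype.card n) • (1 : Matrix n n ℂ) := by
    ext i j; by_cases h : i = j <;> simp [h, Matrix.diagonal]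
  rw [h, mul_add, add_mul, mul_smul_comm, smul_mul_assoc, mul_smul_comm, smul_mul_assoc, mul_one,
    Unitary.mul_star_self_of_mem U.2, smoothing]

theorem posSemidef_conj_diagonal (U : Matrix.unitaryGroup n ℂ) {p : n → ℝ} (hp : ∀ i, 0 ≤ p i) :
    ((U : Matrix n n ℂ) * Matrix.diagonal (fun i => (p i : ℂ)) *
      star (U : Matrix n n ℂ)).PosSemidef := by
  refine Matrix.PosSemidef.mul_mul_conjTranspose_same (Matrix.PosSemidef.diagonal fun i => ?_) _
  exact Complex.zero_le_real.2 (hp i)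

variable [Nonempty n]

theorem trace_smoothing (hσ_tr : σ.trace = 1) : (smoothing δ σ).trace = 1 := by
  have : (Fintype.card n : ℂ) ≠ 0 := by exact_mod_cast Fintype.card_ne_zero
  rw [smoothing, Matrix.trace_add, Matrix.trace_smul, Matrix.trace_smul, hσ_tr, Matrix.trace_one]
  simp only [Complex.real_smul]
  push_cast
  field_simp
  ring

theorem posDef_smoothing (hσ : σ.PosSemidef) (h0 : 0 < δ) (h1 : δ < 1) :
    (smoothing δ σ).PosDef := by
  refine Matrix.PosDef.posSemidef_add (hσ.smul (sub_nonneg.2 h1.le)) (Matrix.PosDef.one.smul ?_)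
  exact div_pos h0 (by exact_mod_cast Fintype.card_pos)

/-- Smoothed eigenvalues are at most `(1 - δ) + δ = 1`. This positivity is what Hölder's inequality
requires later. -/
theorem posSemidef_neg_logb_smoothing (hσ : σ.PosSemidef) (hσ_tr : σ.trace = 1) (h0 : 0 < δ)
    (h1 : δ < 1) : (-cfc (Real.logb 2) (smoothing δ σ)).PosSemidef := by
  obtain ⟨U, p, hp0, hp1, -, rfl⟩ := exists_diagonalization_state hσ hσ_tr
  have hc : (1 : ℝ) ≤ Fintype.card n := by exact_mod_cast Fintype.card_pos
  rw [smoothing_conj_diagonal, cfc_conj_diagonal, ← neg_mul, ← mul_neg, Matrix.diagonal_neg]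
  have := posSemidef_conj_diagonal U (p := fun i =>
    -Real.logb 2 ((1 - δ) * p i + δ / Fintype.card n)) fun i => by
      have a1 : δ / Fintype.card n ≤ δ := div_le_self h0.le hc
      have a2 : 0 < δ / Fintype.card n := div_pos h0 (by linarith)
      have a3 := mul_nonneg (sub_nonneg.2 h1.le) (hp0 i)
      have a4 := mul_le_mul_of_nonneg_left (hp1 i) (sub_nonneg.2 h1.le)
      exact neg_nonneg.2 (Real.logb_nonpos (by norm_num) (by linarith) (by linarith))
  push_cast at this
  exact this

/-- Smoothed eigenvalues are at least `δ / d`, which bounds the negative logarithm independently of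
the state. -/
theorem posSemidef_add_logb_smoothing (hσ : σ.PosSemidef) (hσ_tr : σ.trace = 1) (h0 : 0 < δ)
    (h1 : δ < 1) : (Real.logb 2 (Fintype.card n / δ) • (1 : Matrix n n ℂ) +
      cfc (Real.logb 2) (smoothing δ σ)).PosSemidef := by
  obtain ⟨U, p, hp0, hp1, -, rfl⟩ := exists_diagonalization_state hσ hσ_tr
  have hc : (1 : ℝ) ≤ Fintype.card n := by exact_mod_cast Fintype.card_pos
  have hd : 0 < δ / Fintype.card n := div_pos h0 (by linarith)
  set c := Real.logb 2 (Fintype.card n / δ) with hcdef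
  have hcd : c = -Real.logb 2 (δ / Fintype.card n) := by rw [hcdef, ← Real.logb_inv, inv_div]
  have hone : c • (1 : Matrix n n ℂ) = (U : Matrix n n ℂ) * Matrix.diagonal (fun _ => (c : ℂ)) *
      star (U : Matrix n n ℂ) := by
    have : Matrix.diagonal (fun _ : n => (c : ℂ)) = c • 1 := by
      ext i j; by_cases h : i = j <;> simp [h, Matrix.diagonal]
    rw [this, mul_smul_comm, smul_mul_assoc, mul_one, Unitary.mul_star_self_of_mem U.2]
  rw [smoothing_conj_diagonal, cfc_conj_diagonal, hone, ← add_mul, ← mul_add, Matrix.diagonal_add]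
  have := posSemidef_conj_diagonal U (p := fun i =>
    c + Real.logb 2 ((1 - δ) * p i + δ / Fintype.card n)) fun i => by
      have a3 := mul_nonneg (sub_nonneg.2 h1.le) (hp0 i)
      have := Real.logb_le_logb_of_le (b := 2) (by norm_num) hd
        (by linarith : δ / Fintype.card n ≤ (1 - δ) * p i + δ / Fintype.card n)
      rw [hcd]; linarith
  push_cast at this
  exact this

/-- Smoothing the reference state costs at most `-log (1 - δ)` in cross entropy. -/
theorem neg_trace_mul_logb_smoothing_le (hσ : σ.PosSemidef) (hσ_tr : σ.trace = 1) (h0 : 0 < δ)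
    (h1 : δ < 1) : -(σ * cfc (Real.logb 2) (smoothing δ σ)).trace.re ≤
      entropy σ - Real.logb 2 (1 - δ) := by
  obtain ⟨U, p, hp0, hp1, hps, rfl⟩ := exists_diagonalization_state hσ hσ_tr
  have hc : (1 : ℝ) ≤ Fintype.card n := by exact_mod_cast Fintype.card_pos
  have hd : 0 < δ / Fintype.card n := div_pos h0 (by linarith)
  have hdiag : ∀ r s : n → ℝ, ∑ i, ∑ j, Complex.normSq ((star (U : Matrix n n ℂ) *
      (U : Matrix n n ℂ)) i j) * (r i * s j) = ∑ i, r i * s i := by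
    intro r s
    refine Finset.sum_congr rfl fun i _ => ?_
    rw [Unitary.coe_star_mul_self,
      Finset.sum_eq_single i (fun j _ hj => by simp [Matrix.one_apply_ne hj.symm]) (by simp)]
    simp
  rw [entropy, smoothing_conj_diagonal, cfc_conj_diagonal, cfc_conj_diagonal,
    trace_conj_diagonal_mul_conj_diagonal, trace_conj_diagonal_mul_conj_diagonal, hdiag, hdiag]
  have hpt : ∀ i, p i * Real.logb 2 (p i) + p i * Real.logb 2 (1 - δ) ≤
      p i * Real.logb 2 ((1 - δ) * p i + δ / Fintype.card n) := by
    intro i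
    -- Zero eigenvalues contribute nothing to either side; for the others, drop `δ / d` and use
    -- monotonicity of the logarithm.
    rcases (hp0 i).eq_or_lt with h | h
    · simp [← h]
    · rw [← mul_add, add_comm, ← Real.logb_mul (sub_pos.2 h1).ne' h.ne']
      refine mul_le_mul_of_nonneg_left ?_ h.le
      exact Real.logb_le_logb_of_le (by norm_num) (mul_pos (sub_pos.2 h1) h) (by linarith)
  have := Finset.sum_le_sum fun i (_ : i ∈ Finset.univ) => hpt i
  rw [Finset.sum_add_distrib, ← Finset.sum_mul, hps, one_mul] at this
  linarith

end smoothing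

end crossEntropy

/-! ### The canonical ensemble and the lower bound on the number of outcomes. -/

section converse

variable {n J : Type*} [Fintype n]

theorem minProb_le [Finite J] {ρ : Matrix n n ℂ} {a : J → Matrix n n ℂ} (j : J) :
    minProb ρ a ≤ outcomeProb ρ a j :=
  ciInf_le (Set.finite_range _).bddBelow j

variable [DecidableEq n]

section ensemble

variable {ρ : Matrix n n ℂ} {a : J → Matrix n n ℂ}

theorem trace_msqrt_conj (hρ : ρ.PosSemidef) {N : Matrix n n ℂ} :
    (msqrt ρ * N * msqrt ρ).trace = (ρ * N).trace := by
  rw [Matrix.trace_mul_comm, ← mul_assoc, msqrt_mul_msqrt hρ]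

theorem trace_mul_eq_outcomeProb (hρ : ρ.PosSemidef) {j : J} (ha : (a j).PosSemidef) :
    (ρ * a j).trace = (outcomeProb ρ a j : ℂ) := by
  have h := (posSemidef_msqrt_conj ρ ha).trace_nonneg
  rw [trace_msqrt_conj hρ] at h
  exact Complex.ext rfl (Complex.nonneg_iff.1 h).2.symm

theorem posSemidef_canonicalState {j : J} (ha : (a j).PosSemidef) (hj : 0 < outcomeProb ρ a j) :
    (canonicalState ρ a j).PosSemidef :=
  (posSemidef_msqrt_conj ρ ha).smul (inv_nonneg.2 hj.le)

theorem trace_canonicalState (hρ : ρ.PosSemidef) {j : J} (ha : (a j).PosSemidef)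
    (hj : 0 < outcomeProb ρ a j) : (canonicalState ρ a j).trace = 1 := by
  rw [canonicalState, Matrix.trace_smul, trace_msqrt_conj hρ, trace_mul_eq_outcomeProb hρ ha,
    Complex.real_smul, ← Complex.ofReal_mul, inv_mul_cancel₀ hj.ne', Complex.ofReal_one]

theorem outcomeProb_nonneg (hρ : ρ.PosSemidef) {j : J} (ha : (a j).PosSemidef) :
    0 ≤ outcomeProb ρ a j :=
  re_trace_mul_nonneg hρ ha

variable [Fintype J]

theorem sum_outcomeProb (hρ_tr : ρ.trace = 1) (ha : IsPOVM a) : ∑ j, outcomeProb ρ a j = 1 := by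
  simp only [outcomeProb]
  rw [← Complex.re_sum, ← Matrix.trace_sum, ← Finset.mul_sum, ha.sum_eq_one, mul_one, hρ_tr,
    Complex.one_re]

theorem entropy_eq_zero_of_subsingleton [Subsingleton n] {σ : Matrix n n ℂ} (hσ : σ.trace = 1) :
    entropy σ = 0 := by
  have h1 : σ = 1 := by
    ext i j
    obtain rfl := Subsingleton.elim i j
    rw [Matrix.one_apply_eq, ← hσ, Matrix.trace, Fintype.sum_subsingleton _ i, Matrix.diag_apply]
  rw [entropy, h1, cfc_apply_one (R := ℝ)]
  simp

/-- Dimension one is treated apart, because the estimate absorbing the smoothing cost needs `d ≥ 2`.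
-/
theorem entropyDefect_eq_zero_of_subsingleton [Subsingleton n] (hρ : ρ.PosSemidef)
    (hρ_tr : ρ.trace = 1) (ha : IsPOVM a) (hpos : ∀ j, 0 < outcomeProb ρ a j) :
    entropyDefect ρ a = 0 := by
  rw [entropyDefect, entropy_eq_zero_of_subsingleton hρ_tr, Finset.sum_eq_zero, sub_zero]
  intro j _
  rw [entropy_eq_zero_of_subsingleton (trace_canonicalState hρ (ha.posSemidef j) (hpos j)),
    mul_zero]

end ensemble

variable [Fintype J] [DecidableEq J] {l : ℕ} {κ : Type*} [Fintype κ]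

/-- The number of outcomes of a POVM whose marginals approximate `a` up to `ε`, for an arbitrary
smoothing parameter `δ` of the canonical ensemble. -/
theorem mul_entropyDefect_le [Nonempty n] [Nonempty κ] {ρ : Matrix n n ℂ} (hρ : ρ.PosDef)
    (hρ_tr : ρ.trace = 1) {a : J → Matrix n n ℂ} (ha : IsPOVM a)
    (hpos : ∀ j, 0 < outcomeProb ρ a j) {δ ε : ℝ} (h0 : 0 < δ) (h1 : δ < 1)
    {A : κ → Matrix (Fin l → n) (Fin l → n) ℂ} (hA : IsPOVM A) {guess : κ → Fin l → J}
    (hε : ∀ k, ∑ j, opNorm (marginal ρ A guess k j - a j) ≤ ε) :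
    l * entropyDefect ρ a ≤ Real.logb 2 (Fintype.card κ) +
      l * (ε * Real.logb 2 (Fintype.card n / δ) - Real.logb 2 (1 - δ)) := by
  have hσ j := posSemidef_canonicalState (ha.posSemidef j) (hpos j)
  have hσ_tr j := trace_canonicalState hρ.posSemidef (ha.posSemidef j) (hpos j)
  have hmain := entropy_le_logb_card_sub hρ hρ_tr hA guess
    (τ := fun j => smoothing δ (canonicalState ρ a j))
    (fun j => posDef_smoothing (hσ j) h0 h1) (fun j => trace_smoothing (hσ_tr j))
  set c := Real.logb 2 (Fintype.card n / δ) with hc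
  have hc0 : 0 ≤ c := by
    have hcard : (1 : ℝ) ≤ Fintype.card n := by exact_mod_cast Fintype.card_pos
    exact Real.logb_nonneg (by norm_num) ((one_le_div h0).2 (by linarith))
  -- `N j` is the local observable paired with the marginals; it is positive with trace at most `log
  -- (d/δ)`.
  let N : J → Matrix n n ℂ := fun j =>
    msqrt ρ * -cfc (Real.logb 2) (smoothing δ (canonicalState ρ a j)) * msqrt ρ
  have hN j : (N j).PosSemidef :=
    posSemidef_msqrt_conj ρ (posSemidef_neg_logb_smoothing (hσ j) (hσ_tr j) h0 h1)
  have hNtr j : (N j).trace.re ≤ c := by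
    have h := re_trace_mul_nonneg hρ.posSemidef
      (posSemidef_add_logb_smoothing (hσ j) (hσ_tr j) h0 h1)
    rw [mul_add, mul_smul_comm, mul_one, Matrix.trace_add, Matrix.trace_smul, hρ_tr,
      Complex.add_re, Complex.real_smul, mul_one, Complex.ofReal_re] at h
    rw [trace_msqrt_conj hρ.posSemidef, mul_neg, Matrix.trace_neg, Complex.neg_re]
    linarith
  -- Cyclicity of the trace moves the two factors `√ρ` onto `a j`, producing `λ_j ρ̂_j`.
  have haN j : (a j * N j).trace.re ≤ outcomeProb ρ a j *
      (entropy (canonicalState ρ a j) - Real.logb 2 (1 - δ)) := by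
    have h := mul_le_mul_of_nonneg_left
      (neg_trace_mul_logb_smoothing_le (hσ j) (hσ_tr j) h0 h1) (hpos j).le
    refine le_trans (le_of_eq ?_) h
    have e : (outcomeProb ρ a j) • canonicalState ρ a j = msqrt ρ * a j * msqrt ρ := by
      rw [canonicalState, smul_smul, mul_inv_cancel₀ (hpos j).ne', one_smul]
    rw [mul_neg, ← Complex.re_ofReal_mul, ← Complex.real_smul, ← Matrix.trace_smul,
      ← smul_mul_assoc, e, ← mul_assoc, Matrix.trace_mul_comm, mul_neg, mul_neg, mul_neg,
      Matrix.trace_neg, Complex.neg_re]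
    simp only [mul_assoc]
  have hterm : ∀ k j, -(marginal ρ A guess k j * (msqrt ρ *
      cfc (Real.logb 2) (smoothing δ (canonicalState ρ a j)) * msqrt ρ)).trace.re ≤
      opNorm (marginal ρ A guess k j - a j) * c + outcomeProb ρ a j *
      (entropy (canonicalState ρ a j) - Real.logb 2 (1 - δ)) := by
    intro k j
    have e : -(marginal ρ A guess k j * (msqrt ρ *
        cfc (Real.logb 2) (smoothing δ (canonicalState ρ a j)) * msqrt ρ)).trace.re =
        ((marginal ρ A guess k j - a j) * N j).trace.re + (a j * N j).trace.re := by
      rw [sub_mul, Matrix.trace_sub, Complex.sub_re, sub_add_cancel]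
      simp only [N, mul_neg, neg_mul, Matrix.trace_neg, Complex.neg_re]
    rw [e]
    refine add_le_add ((le_abs_self _).trans ((abs_trace_mul_le _ (hN j)).trans ?_)) (haN j)
    exact mul_le_mul_of_nonneg_left (hNtr j) (norm_nonneg _)
  have hk : ∀ k : Fin l, -∑ j, (marginal ρ A guess k j * (msqrt ρ *
      cfc (Real.logb 2) (smoothing δ (canonicalState ρ a j)) * msqrt ρ)).trace.re ≤
      ε * c + ∑ j, outcomeProb ρ a j * entropy (canonicalState ρ a j) - Real.logb 2 (1 - δ) := by
    intro k
    have h := Finset.sum_le_sum (s := Finset.univ) fun j _ => hterm k j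
    simp only [mul_sub] at h
    rw [Finset.sum_neg_distrib, Finset.sum_add_distrib, Finset.sum_sub_distrib, ← Finset.sum_mul,
      ← Finset.sum_mul, sum_outcomeProb hρ_tr ha, one_mul] at h
    have := mul_le_mul_of_nonneg_right (hε k) hc0
    linarith
  have hsum := Finset.sum_le_sum (s := Finset.univ) fun k _ => hk k
  rw [Finset.sum_neg_distrib, Finset.sum_const, Finset.card_univ, Fintype.card_fin,
    nsmul_eq_mul] at hsum
  rw [entropyDefect]
  linarith

/-! ### Choice of the smoothing parameter and the error term. -/

/-- By concavity the logarithm lies above its chord between `1/2` and `1`. -/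
theorem neg_logb_one_sub_le {x : ℝ} (h0 : 0 ≤ x) (h1 : x ≤ 1 / 2) :
    -Real.logb 2 (1 - x) ≤ 2 * x := by
  have h := strictConcaveOn_log_Ioi.concaveOn.2 (show (1 / 2 : ℝ) ∈ Set.Ioi 0 by norm_num)
    (show (1 : ℝ) ∈ Set.Ioi 0 by norm_num) (show 0 ≤ 2 * x by linarith)
    (show 0 ≤ 1 - 2 * x by linarith) (by ring)
  simp only [smul_eq_mul, Real.log_one, mul_zero, add_zero, one_div, Real.log_inv] at h
  rw [show 2 * x * 2⁻¹ + (1 - 2 * x) * 1 = 1 - x by ring] at h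
  have hl : 0 < Real.log 2 := Real.log_pos (by norm_num)
  rw [Real.logb, ← neg_div, div_le_iff₀ hl]
  linarith

/-- Put `L = log (d/(2u))`. The first term is at most `u L`; the second is at most `4u ≤ 2u L`,
because `d/(2u) ≥ 4`. This is the source of the factor `3`. -/
theorem smoothing_error_le {d u ε : ℝ} (hd : 2 ≤ d) (hu : 0 < u) (hu' : u ≤ 1 / 4) (hε : ε ≤ u) :
    ε * Real.logb 2 (d / (2 * u)) - Real.logb 2 (1 - 2 * u) ≤
      -(3 * u * Real.logb 2 (2 * u / d)) := by
  have h1 := neg_logb_one_sub_le (x := 2 * u) (by linarith) (by linarith)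
  have h2 : Real.logb 2 (2 * u / d) = -Real.logb 2 (d / (2 * u)) := by
    rw [← Real.logb_inv, inv_div]
  have h3 : 2 ≤ Real.logb 2 (d / (2 * u)) := by
    rw [Real.le_logb_iff_rpow_le (by norm_num) (by positivity), le_div_iff₀ (by linarith)]
    norm_num
    linarith
  rw [h2]
  have h4 := mul_le_mul_of_nonneg_right hε (by linarith : 0 ≤ Real.logb 2 (d / (2 * u)))
  have h5 := mul_le_mul_of_nonneg_left h3 hu.le
  linarith

theorem two_rpow_le_of_marginal_close {ρ : Matrix n n ℂ} (hρ : ρ.PosDef)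
    (hρ_tr : ρ.trace = 1) {a : J → Matrix n n ℂ} (ha : IsPOVM a) {ε : ℝ} (hε : 0 < ε)
    (hε' : ε ≤ (minProb ρ a / 2) ^ 2) {A : κ → Matrix (Fin l → n) (Fin l → n) ℂ} (hA : IsPOVM A)
    {guess : κ → Fin l → J} (hclose : ∀ k, ∑ j, opNorm (marginal ρ A guess k j - a j) ≤ ε) :
    (2 : ℝ) ^ ((l : ℝ) * (entropyDefect ρ a + 3 * ε / minProb ρ a ^ 2 *
      Real.logb 2 (2 * ε / (minProb ρ a ^ 2 * Fintype.card n)))) ≤ Fintype.card κ := by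
  have : Nonempty n := by
    by_contra h
    rw [not_nonempty_iff] at h
    simp [Matrix.trace] at hρ_tr
  have : Nonempty J := by
    by_contra h
    rw [not_nonempty_iff] at h
    have := sum_outcomeProb hρ_tr ha
    simp at this
  have : Nonempty κ := by
    by_contra h
    rw [not_nonempty_iff] at h
    have := hA.sum_eq_one
    simp at this
  have hmin0 : 0 ≤ minProb ρ a :=
    le_ciInf fun j => outcomeProb_nonneg hρ.posSemidef (ha.posSemidef j)
  -- Positivity of `λ₀` is forced by `0 < ε ≤ (λ₀/2)²`.
  have hmin : 0 < minProb ρ a := by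
    refine hmin0.lt_of_ne fun h => ?_
    rw [← h] at hε'
    norm_num at hε'
    linarith
  have hpos j : 0 < outcomeProb ρ a j := hmin.trans_le (minProb_le j)
  have hmin1 : minProb ρ a ≤ 1 := by
    obtain ⟨j⟩ := ‹Nonempty J›
    refine (minProb_le j).trans ?_
    rw [← sum_outcomeProb hρ_tr ha]
    exact Finset.single_le_sum (fun i _ => (hpos i).le) (Finset.mem_univ j)
  have hsq : 0 < minProb ρ a ^ 2 := by positivity
  set u := ε / minProb ρ a ^ 2 with hu
  have hu0 : 0 < u := div_pos hε hsq
  have hu1 : u ≤ 1 / 4 := by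
    rw [hu, div_le_iff₀ hsq]
    linarith
  have hεu : ε ≤ u := by
    rw [hu, le_div_iff₀ hsq]
    exact mul_le_of_le_one_right hε.le (pow_le_one₀ hmin0 hmin1)
  have e1 : 3 * ε / minProb ρ a ^ 2 = 3 * u := by rw [hu]; ring
  have e2 : 2 * ε / (minProb ρ a ^ 2 * Fintype.card n) = 2 * u / Fintype.card n := by
    rw [hu, ← div_div, mul_div_assoc]
  rw [e1, e2]
  have hM : (1 : ℝ) ≤ Fintype.card κ := by exact_mod_cast Fintype.card_pos
  have hcard : (1 : ℝ) ≤ Fintype.card n := by exact_mod_cast Fintype.card_pos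
  suffices h : (l : ℝ) * (entropyDefect ρ a + 3 * u * Real.logb 2 (2 * u / Fintype.card n)) ≤
      Real.logb 2 (Fintype.card κ) from
    (Real.le_logb_iff_rpow_le (by norm_num) (by linarith)).1 h
  -- In dimension one the defect vanishes and the error term is nonpositive, so having one outcome
  -- is enough.
  rcases le_or_gt (Fintype.card n) 1 with h | h
  · have := Fintype.card_le_one_iff_subsingleton.1 h
    rw [entropyDefect_eq_zero_of_subsingleton hρ.posSemidef hρ_tr ha hpos, zero_add]
    refine (mul_nonpos_of_nonneg_of_nonpos (Nat.cast_nonneg l) ?_).trans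
      (Real.logb_nonneg (by norm_num) hM)
    refine mul_nonpos_of_nonneg_of_nonpos (by positivity) ?_
    refine Real.logb_nonpos (by norm_num) (by positivity) ?_
    rw [div_le_one (by linarith)]
    linarith
  · have h2 : (2 : ℝ) ≤ Fintype.card n := by exact_mod_cast h
    -- The smoothing weight is `2u = 2ε/λ₀²`, at most `1/2` because `u ≤ 1/4`.
    have hmain := mul_entropyDefect_le hρ hρ_tr ha hpos (δ := 2 * u) (by linarith) (by linarith)
      hA hclose
    have herr := mul_le_mul_of_nonneg_left (smoothing_error_le h2 hu0 hu1 hεu)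
      (Nat.cast_nonneg (α := ℝ) l)
    linarith

/-- Up to a constant factor the error is `x log x` with `x = 2ε/(c² d)`, which is continuous with
value `0` at `x = 0`. -/
theorem exists_error_le {c d δ : ℝ} (hc : 0 < c) (hd : 0 < d) (hδ : 0 < δ) :
    ∃ ε, 0 < ε ∧ ε ≤ (c / 2) ^ 2 ∧
      -δ ≤ 3 * ε / c ^ 2 * Real.logb 2 (2 * ε / (c ^ 2 * d)) := by
  have hcont : Continuous fun ε : ℝ =>
      3 * d / 2 / Real.log 2 * ((2 * ε / (c ^ 2 * d)) * Real.log (2 * ε / (c ^ 2 * d))) :=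
    continuous_const.mul (Real.continuous_mul_log.comp (by fun_prop))
  have ht := hcont.tendsto 0
  simp only [mul_zero, zero_div, zero_mul] at ht
  have h1 := (ht.eventually (eventually_ge_nhds (neg_lt_zero.2 hδ))).filter_mono
    (nhdsWithin_le_nhds (s := Set.Ioi 0))
  have h2 : ∀ᶠ ε in nhdsWithin (0 : ℝ) (Set.Ioi 0), ε ∈ Set.Ioc 0 ((c / 2) ^ 2) :=
    Ioc_mem_nhdsGT (by positivity)
  obtain ⟨ε, hε1, hε2⟩ := (h1.and h2).exists
  refine ⟨ε, hε2.1, hε2.2, hε1.trans (le_of_eq ?_)⟩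
  rw [Real.logb]
  field_simp

end converse

end MeasurementCompression

end

/-! ### The bound for fixed error and the optimality of the rate. -/

theorem theorem3 {d m : ℕ}
    (ρ : Matrix (Fin d) (Fin d) ℂ) (hρ : ρ.PosDef) (hρ_tr : ρ.trace = 1)
    (a : Fin m → Matrix (Fin d) (Fin d) ℂ) (ha : MeasurementCompression.IsPOVM a) :
    -- the lower bound on the number of outcomes
    (∀ ε : ℝ, 0 < ε → ε ≤ (MeasurementCompression.minProb ρ a / 2) ^ 2 →
      ∀ (l M : ℕ) (A : Fin M → Matrix (Fin l → Fin d) (Fin l → Fin d) ℂ)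
        (guess : Fin M → Fin l → Fin m),
        MeasurementCompression.IsPOVM A →
        (∀ k : Fin l, ∑ j : Fin m, MeasurementCompression.opNorm
          (MeasurementCompression.marginal ρ A guess k j - a j) ≤ ε) →
        (2 : ℝ) ^ ((l : ℝ) * (MeasurementCompression.entropyDefect ρ a +
            3 * ε / MeasurementCompression.minProb ρ a ^ 2 *
              Real.logb 2 (2 * ε / (MeasurementCompression.minProb ρ a ^ 2 * (d : ℝ))))) ≤ (M : ℝ)) ∧
    -- asymptotic optimality: no rate below the entropy defect suffices for small errors
    (0 < MeasurementCompression.minProb ρ a →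
      ∀ δ : ℝ, 0 < δ → ∃ ε₀ : ℝ, 0 < ε₀ ∧
      ∀ (l M : ℕ) (A : Fin M → Matrix (Fin l → Fin d) (Fin l → Fin d) ℂ)
        (guess : Fin M → Fin l → Fin m),
        MeasurementCompression.IsPOVM A →
        (∀ k : Fin l, ∑ j : Fin m, MeasurementCompression.opNorm
          (MeasurementCompression.marginal ρ A guess k j - a j) ≤ ε₀) →
        (2 : ℝ) ^ ((l : ℝ) * (MeasurementCompression.entropyDefect ρ a - δ)) ≤ (M : ℝ)) := by
  have main : ∀ ε : ℝ, 0 < ε → ε ≤ (MeasurementCompression.minProb ρ a / 2) ^ 2 →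
      ∀ (l M : ℕ) (A : Fin M → Matrix (Fin l → Fin d) (Fin l → Fin d) ℂ)
        (guess : Fin M → Fin l → Fin m),
        MeasurementCompression.IsPOVM A →
        (∀ k : Fin l, ∑ j : Fin m, MeasurementCompression.opNorm
          (MeasurementCompression.marginal ρ A guess k j - a j) ≤ ε) →
        (2 : ℝ) ^ ((l : ℝ) * (MeasurementCompression.entropyDefect ρ a +
            3 * ε / MeasurementCompression.minProb ρ a ^ 2 *
              Real.logb 2 (2 * ε / (MeasurementCompression.minProb ρ a ^ 2 * (d : ℝ))))) ≤
          (M : ℝ) := by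
    intro ε hε hε' l M A guess hA hclose
    simpa using MeasurementCompression.two_rpow_le_of_marginal_close hρ hρ_tr ha hε hε' hA hclose
  refine ⟨main, fun hmin δ hδ => ?_⟩
  have hd : (0 : ℝ) < d := by
    rcases Nat.eq_zero_or_pos d with rfl | h
    · simp [Matrix.trace] at hρ_tr
    · exact_mod_cast h
  -- `ε₀` depends only on `λ₀`, `d` and `δ`, hence is uniform in `l` and in the POVM.
  obtain ⟨ε₀, h0, h1, h2⟩ := MeasurementCompression.exists_error_le hmin hd hδ
  refine ⟨ε₀, h0, fun l M A guess hA hclose => le_trans ?_ (main ε₀ h0 h1 l M A guess hA hclose)⟩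
  refine Real.rpow_le_rpow_of_exponent_le (by norm_num) ?_
  refine mul_le_mul_of_nonneg_left ?_ (Nat.cast_nonneg l)
  linarith
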